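/- Let $\Lambda=\prod_{j=1}^d (a_j,b_j)\subset\mathbb{R}^d$ with $a_j,b_j\in\mathbb{R}\cup\{\pm\infty\}$, $a_j<b_j$, and let $V\colon\Lambda\to\mathbb{R}$ be measurable and admissible on $\Lambda$, that is, the domain $\mathcal{D}(V)=\{\psi\in L^2(\Lambda): V\psi\in L^2(\Lambda)\}$ of the multiplication operator by $V$ in the complex Hilbert space $L^2(\Lambda)$ contains $H^1(\Lambda)$. For $\bullet\in\{D,N,\mathrm{per}\}$ let $-\Delta_\Lambda^\bullet$ be the Dirichlet, Neumann, respectively periodic Laplacian on $\Lambda$, i.e. the self-adjoint operator associated with the form $\int_\Lambda \nabla u\cdot\overline{\nabla v}$ on $H^1_0(\Lambda)$, $H^1(\Lambda)$, respectively $H^1_{\mathrm{per}}(\Lambda)$; the case $\bullet=\mathrm{per}$ is considered only if each interval $(a_j,b_j)$ is bounded or equal to $\mathbb{R}$, and $H^1_{\mathrm{per}}(\Lambda)$ consists of the $u\in H^1(\Lambda)$ whose traces on opposite faces of $\Lambda$ in the bounded directions coincide. Then: (a) For each such $\bullet$, $V$ is infinitesimally operator bounded with respect to $\Delta_\Lambda^\bullet$: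 $\mathcal{D}(\Delta_\Lambda^\bullet)\subset\mathcal{D}(V)$, and for every $\eta>0$ there is $C\ge 0$ with $\|V\psi\|\le\eta\|\Delta_\Lambda^\bullet\psi\|+C\|\psi\|$ for all $\psi\in\mathcal{D}(\Delta_\Lambda^\bullet)$. More precisely, there are constants $a,b\ge 0$ such that $$\|V\psi\|_{L^2(\Lambda)}\le a\varepsilon\,\|\Delta_\Lambda^\bullet\psi\|_{L^2(\Lambda)}+\Bigl(\frac a\varepsilon+b\Bigr)\|\psi\|_{L^2(\Lambda)}$$ for all $\psi\in\mathcal{D}(\Delta_\Lambda^\bullet)$ and all $\varepsilon>0$. (b) There are constants $\lambda_1,\lambda_2\ge 0$ such that $$\|V\psi\|_{L^2(\Lambda)}^2\le\lambda_1\|\nabla\psi\|_{L^2(\Lambda)}^2+\lambda_2\|\psi\|_{L^2(\Lambda)}^2$$ for all $\psi\in H^1(\Lambda)$. -/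

import Mathlib

open MeasureTheory TopologicalSpace
open scoped ContDiff

noncomputable section

namespace GenRect

/-- The space `ℝ^d` with its Euclidean structure. -/
abbrev Space (d : ℕ) := EuclideanSpace ℝ (Fin d)

/-- The `j`-th classical partial derivative of a scalar function on `ℝ^d`. -/
def partialDeriv {d : ℕ} (j : Fin d) (φ : Space d → ℝ) (x : Space d) : ℝ :=
  fderiv ℝ φ x (EuclideanSpace.single j 1)

/-- The generalized rectangle `⨉_j (a_j, b_j)`, where `a_j` and `b_j` may be infinite. -/
def box {d : ℕ} (a b : Fin d → EReal) : Opens (Space d) where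
  carrier := {x | ∀ j, a j < ((x j : ℝ) : EReal) ∧ ((x j : ℝ) : EReal) < b j}
  is_open' := by
    have hc : ∀ j, Continuous fun x : Space d => ((x j : ℝ) : EReal) := fun j =>
      continuous_coe_real_ereal.comp (EuclideanSpace.proj (𝕜 := ℝ) j).continuous
    simp only [Set.ofPred_forall]
    exact isOpen_iInter_of_finite fun j =>
      (isOpen_lt continuous_const (hc j)).inter (isOpen_lt (hc j) continuous_const)

/-- The complex Hilbert space `L²(Λ)`. -/
abbrev L2 {d : ℕ} (Λ : Opens (Space d)) := Lp ℂ 2 (volume.restrict (Λ : Set (Space d)))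

/-- The complex Hilbert space `L²(Λ)^d` of vector fields, with norm
`‖g‖² = ∑ j, ‖g j‖²`. -/
abbrev L2Field {d : ℕ} (Λ : Opens (Space d)) := PiLp 2 (fun _ : Fin d => L2 Λ)

/-- The space of all `ψ ∈ L²(Λ)` with `V ψ ∈ L²(Λ)`. -/
def mulDomain {d : ℕ} (Λ : Opens (Space d)) (V : Space d → ℝ) : Submodule ℂ (L2 Λ) where
  carrier := {ψ | MemLp (fun x => (V x : ℂ) * ψ x) 2 (volume.restrict (Λ : Set (Space d)))}
  zero_mem' := by
    refine (memLp_congr_ae ?_).2 (MemLp.zero' (ε := ℂ))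
    filter_upwards [Lp.coeFn_zero ℂ 2 (volume.restrict (Λ : Set (Space d)))] with x hx
    rw [hx, Pi.zero_apply, mul_zero]
  add_mem' := by
    intro u v hu hv
    refine (memLp_congr_ae ?_).2 (MemLp.add hu hv)
    filter_upwards [Lp.coeFn_add u v] with x hx
    rw [hx, Pi.add_apply, Pi.add_apply, mul_add]
  smul_mem' := by
    intro c u hu
    refine (memLp_congr_ae ?_).2 (MemLp.const_smul hu c)
    filter_upwards [Lp.coeFn_smul c u] with x hx
    rw [hx, Pi.smul_apply, Pi.smul_apply, smul_eq_mul, smul_eq_mul, mul_left_comm]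

/-- The class of `V ψ` in `L²(Λ)`. -/
def mulFun {d : ℕ} (Λ : Opens (Space d)) (V : Space d → ℝ) (ψ : L2 Λ) (hψ : ψ ∈ mulDomain Λ V) :
    L2 Λ :=
  MemLp.toLp (fun x => (V x : ℂ) * ψ x) hψ

lemma coeFn_mulFun {d : ℕ} (Λ : Opens (Space d)) (V : Space d → ℝ) (ψ : L2 Λ)
    (hψ : ψ ∈ mulDomain Λ V) :
    mulFun Λ V ψ hψ =ᵐ[volume.restrict (Λ : Set (Space d))] fun x => (V x : ℂ) * ψ x :=
  MemLp.coeFn_toLp hψ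

lemma mulFun_add {d : ℕ} (Λ : Opens (Space d)) (V : Space d → ℝ) (u v : L2 Λ)
    (hu : u ∈ mulDomain Λ V) (hv : v ∈ mulDomain Λ V) (huv : u + v ∈ mulDomain Λ V) :
    mulFun Λ V (u + v) huv = mulFun Λ V u hu + mulFun Λ V v hv := by
  apply Lp.ext
  filter_upwards [Lp.coeFn_add u v, Lp.coeFn_add (mulFun Λ V u hu) (mulFun Λ V v hv),
    coeFn_mulFun Λ V u hu, coeFn_mulFun Λ V v hv, coeFn_mulFun Λ V _ huv] with x h1 h2 h3 h4 h5
  rw [h2, h5, h1, Pi.add_apply, Pi.add_apply, h3, h4, mul_add]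

lemma mulFun_smul {d : ℕ} (Λ : Opens (Space d)) (V : Space d → ℝ) (c : ℂ) (u : L2 Λ)
    (hu : u ∈ mulDomain Λ V) (hcu : c • u ∈ mulDomain Λ V) :
    mulFun Λ V (c • u) hcu = c • mulFun Λ V u hu := by
  apply Lp.ext
  filter_upwards [Lp.coeFn_smul c u, Lp.coeFn_smul c (mulFun Λ V u hu),
    coeFn_mulFun Λ V u hu, coeFn_mulFun Λ V _ hcu] with x h1 h2 h3 h5
  rw [h2, h5, h1, Pi.smul_apply, Pi.smul_apply, h3, smul_eq_mul, smul_eq_mul, mul_left_comm]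

/-- The maximal multiplication operator `ψ ↦ V ψ` in `L²(Λ)`. -/
def mulOp {d : ℕ} (Λ : Opens (Space d)) (V : Space d → ℝ) : L2 Λ →ₗ.[ℂ] L2 Λ where
  domain := mulDomain Λ V
  toFun :=
    { toFun := fun ψ => mulFun Λ V ψ.1 ψ.2
      map_add' := fun u v => mulFun_add Λ V u.1 v.1 u.2 v.2 (u + v).2
      map_smul' := fun c u => mulFun_smul Λ V c u.1 u.2 (c • u).2 }

lemma integral_smul_zero {d : ℕ} (Λ : Opens (Space d)) (χ : Space d → ℝ) :
    ∫ x in (Λ : Set (Space d)), χ x • (0 : L2 Λ) x = 0 := by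
  refine integral_eq_zero_of_ae ?_
  filter_upwards [Lp.coeFn_zero ℂ 2 (volume.restrict (Λ : Set (Space d)))] with x hx
  rw [hx, Pi.zero_apply, smul_zero]

lemma memLp_of_isBounded {d : ℕ} (Λ : Opens (Space d)) {φ : Space d → ℝ} (hφ : Continuous φ)
    (hb : Bornology.IsBounded ((Λ : Set (Space d)) ∩ Function.support φ)) :
    MemLp φ 2 (volume.restrict (Λ : Set (Space d))) := by
  set s := (Λ : Set (Space d)) ∩ Function.support φ with hs
  have hsm : MeasurableSet s :=
    Λ.isOpen.measurableSet.inter (hφ.measurable (measurableSet_singleton 0).compl)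
  have hK : IsCompact (closure s) := hb.isCompact_closure
  obtain ⟨C, hC⟩ := hK.exists_bound_of_continuousOn hφ.continuousOn
  have h1 : MemLp (s.indicator φ) 2 (volume.restrict (Λ : Set (Space d))) := by
    rw [memLp_indicator_iff_restrict hsm]
    have : IsFiniteMeasure ((volume.restrict (Λ : Set (Space d))).restrict s) := by
      constructor
      rw [Measure.restrict_apply_univ]
      exact (Measure.restrict_apply_le _ _).trans_lt hb.measure_lt_top
    refine MemLp.of_bound hφ.aestronglyMeasurable C ?_
    filter_upwards [ae_restrict_mem hsm] with x hx using hC x (subset_closure hx)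
  refine (memLp_congr_ae ?_).2 h1
  filter_upwards [ae_restrict_mem Λ.isOpen.measurableSet] with x hx
  by_cases h0 : φ x = 0
  · simp [Set.indicator, h0]
  · rw [Set.indicator_of_mem]
    exact ⟨hx, h0⟩

lemma isBounded_partialDeriv {d : ℕ} (Λ : Opens (Space d)) {φ : Space d → ℝ} (j : Fin d)
    (hb : Bornology.IsBounded ((Λ : Set (Space d)) ∩ Function.support φ)) :
    Bornology.IsBounded ((Λ : Set (Space d)) ∩ Function.support (partialDeriv j φ)) := by
  refine hb.closure.subset fun x hx => ?_
  have h2 : x ∈ tsupport φ := by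
    by_contra hn
    apply hx.2
    have : fderiv ℝ φ x = 0 := by
      by_contra h
      exact hn (support_fderiv_subset ℝ h)
    simp [partialDeriv, this]
  exact Λ.isOpen.inter_closure ⟨hx.1, h2⟩

lemma continuous_partialDeriv {d : ℕ} {φ : Space d → ℝ} (j : Fin d) (hφ : ContDiff ℝ ∞ φ) :
    Continuous (partialDeriv j φ) :=
  (hφ.continuous_fderiv (by simp)).clm_apply continuous_const

lemma integrable_smul_L2 {d : ℕ} (Λ : Opens (Space d)) {φ : Space d → ℝ} (hφ : Continuous φ)
    (hb : Bornology.IsBounded ((Λ : Set (Space d)) ∩ Function.support φ)) (u : L2 Λ) :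
    Integrable (fun x => φ x • u x) (volume.restrict (Λ : Set (Space d))) := by
  have := (memLp_of_isBounded Λ hφ hb).ofReal (K := ℂ)
  have h := MemLp.integrable_mul this (Lp.memLp u)
  refine h.congr (Filter.Eventually.of_forall fun x => ?_)
  simp

/-- All pairs `(u, g) ∈ L²(Λ) × L²(Λ)^d` with `∫_Λ (∂_j φ) u = - ∫_Λ φ g_j` for all `j` and all
smooth `φ : ℝ^d → ℝ` such that `φ` has bounded support within `Λ` and satisfies `P`. -/
def partsGraph {d : ℕ} (Λ : Opens (Space d)) (P : (Space d → ℝ) → Prop) :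
    Submodule ℂ (L2 Λ × L2Field Λ) where
  carrier := {p | ∀ (j : Fin d) (φ : Space d → ℝ), ContDiff ℝ ∞ φ →
    Bornology.IsBounded ((Λ : Set (Space d)) ∩ Function.support φ) → P φ →
    ∫ x in (Λ : Set (Space d)), partialDeriv j φ x • p.1 x
      = - ∫ x in (Λ : Set (Space d)), φ x • p.2 j x}
  zero_mem' := by
    intro j φ hφ hb hP
    have h1 := integral_smul_zero Λ (partialDeriv j φ)
    have h2 := integral_smul_zero Λ φ
    simp only [Prod.fst_zero, Prod.snd_zero, PiLp.zero_apply]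
    rw [h1, h2, neg_zero]
  add_mem' := by
    intro p q hp hq j φ hφ hb hP
    have key : ∀ χ : Space d → ℝ, Continuous χ →
        Bornology.IsBounded ((Λ : Set (Space d)) ∩ Function.support χ) → ∀ u v : L2 Λ,
        ∫ x in (Λ : Set (Space d)), χ x • (u + v : L2 Λ) x =
          (∫ x in (Λ : Set (Space d)), χ x • u x) + ∫ x in (Λ : Set (Space d)), χ x • v x := by
      intro χ hχ hχb u v
      rw [← integral_add (integrable_smul_L2 Λ hχ hχb u) (integrable_smul_L2 Λ hχ hχb v)]
      refine integral_congr_ae ?_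
      filter_upwards [Lp.coeFn_add u v] with x hx
      rw [hx, Pi.add_apply, smul_add]
    have h1 := key _ (continuous_partialDeriv j hφ) (isBounded_partialDeriv Λ j hb) p.1 q.1
    have h2 := key _ hφ.continuous hb (p.2 j) (q.2 j)
    simp only [Prod.fst_add, Prod.snd_add, PiLp.add_apply]
    rw [h1, h2, hp j φ hφ hb hP, hq j φ hφ hb hP]
    ring
  smul_mem' := by
    intro c p hp j φ hφ hb hP
    have key : ∀ (χ : Space d → ℝ) (u : L2 Λ),
        ∫ x in (Λ : Set (Space d)), χ x • (c • u : L2 Λ) x =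
          c * ∫ x in (Λ : Set (Space d)), χ x • u x := by
      intro χ u
      rw [← integral_const_mul]
      refine integral_congr_ae ?_
      filter_upwards [Lp.coeFn_smul c u] with x hx
      simp only [hx, Pi.smul_apply, smul_eq_mul, Complex.real_smul]
      ring
    simp only [Prod.smul_fst, Prod.smul_snd, PiLp.smul_apply]
    rw [key, key, hp j φ hφ hb hP]
    ring

/-- The condition that makes a smooth `φ` a test function on `Λ`, i.e. an element of
`C_c^∞(Λ)`. -/
def CompactlySupportedIn {d : ℕ} (Λ : Opens (Space d)) {F : Type*} [Zero F]
    (φ : Space d → F) : Prop :=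
  HasCompactSupport φ ∧ tsupport φ ⊆ (Λ : Set (Space d))

/-- The pairs `(u, ∇u)`, where `u ∈ L²(Λ)` has weak (distributional) gradient
`∇u ∈ L²(Λ)^d`. -/
def gradGraph {d : ℕ} (Λ : Opens (Space d)) : Submodule ℂ (L2 Λ × L2Field Λ) :=
  partsGraph Λ (CompactlySupportedIn Λ)

/-- The gradient as an operator from `L²(Λ)` to `L²(Λ)^d` with domain `H¹(Λ)`, given by the weak
derivatives (`grad_graph` below shows that the weak gradient is unique). -/
def grad {d : ℕ} (Λ : Opens (Space d)) : L2 Λ →ₗ.[ℂ] L2Field Λ :=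
  (gradGraph Λ).toLinearPMap

/-- The Sobolev space `H¹(Λ)` as a subspace of `L²(Λ)`. -/
def H1 {d : ℕ} (Λ : Opens (Space d)) : Submodule ℂ (L2 Λ) := (grad Λ).domain

/-- `V` is admissible on `Λ`: it is (Lebesgue) measurable on `Λ`, and the domain of the
multiplication operator by `V` contains `H¹(Λ)`. -/
def IsAdmissible {d : ℕ} (Λ : Opens (Space d)) (V : Space d → ℝ) : Prop :=
  AEMeasurable V (volume.restrict (Λ : Set (Space d))) ∧ H1 Λ ≤ (mulOp Λ V).domain

/-- The subspace of `L²(Λ)` formed by the (classes of) functions in `C_c^∞(Λ)`. -/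
def testSpace {d : ℕ} (Λ : Opens (Space d)) : Submodule ℂ (L2 Λ) where
  carrier := {u | ∃ φ : Space d → ℂ, ContDiff ℝ ∞ φ ∧ CompactlySupportedIn Λ φ ∧
    u =ᵐ[volume.restrict (Λ : Set (Space d))] φ}
  zero_mem' := ⟨0, contDiff_const, by simp [CompactlySupportedIn, HasCompactSupport], Lp.coeFn_zero _ _ _⟩
  add_mem' := by
    rintro u v ⟨φ, h1, ⟨h2, h3⟩, h4⟩ ⟨χ, k1, ⟨k2, k3⟩, k4⟩
    refine ⟨φ + χ, h1.add k1, ⟨h2.add k2, ?_⟩, ?_⟩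
    · exact (tsupport_add φ χ).trans (Set.union_subset h3 k3)
    · filter_upwards [Lp.coeFn_add u v, h4, k4] with x hx hx1 hx2
      rw [hx, Pi.add_apply, Pi.add_apply, hx1, hx2]
  smul_mem' := by
    rintro c u ⟨φ, h1, ⟨h2, h3⟩, h4⟩
    have hsub : tsupport (fun x => c • φ x) ⊆ tsupport φ :=
      tsupport_smul_subset_right (fun _ => c) φ
    refine ⟨fun x => c • φ x, h1.const_smul c, ⟨?_, hsub.trans h3⟩, ?_⟩
    · exact h2.of_isClosed_subset (isClosed_tsupport _) hsub
    · filter_upwards [Lp.coeFn_smul c u, h4] with x hx hx1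
      rw [hx, Pi.smul_apply, hx1]

/-- The three boundary conditions: Dirichlet, Neumann and periodic. -/
inductive BoundaryCondition
  | dirichlet
  | neumann
  | periodic

/-- Dirichlet and Neumann conditions always make sense. Periodic conditions make sense if each
interval `(a_j, b_j)` is bounded or the whole line. -/
def BoundaryCondition.Applicable {d : ℕ} (a b : Fin d → EReal) : BoundaryCondition → Prop
  | dirichlet => True
  | neumann => True
  | periodic => ∀ j, (a j ≠ ⊥ ∧ b j ≠ ⊤) ∨ (a j = ⊥ ∧ b j = ⊤)

/-- `φ : ℝ^d → ℝ` is `(b_j - a_j)`-periodic in each direction `j` with `(a_j, b_j)` bounded. -/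
def IsBoxPeriodic {d : ℕ} (a b : Fin d → EReal) (φ : Space d → ℝ) : Prop :=
  ∀ j, a j ≠ ⊥ → b j ≠ ⊤ → ∀ x,
    φ (x + EuclideanSpace.single j ((b j).toReal - (a j).toReal)) = φ x

/-- The pairs `(u, ∇u)` for `u` in the form domain of the Laplacian on `Λ = ⨉_j (a_j, b_j)`:
* Dirichlet: `u ∈ H¹₀(Λ)`, the closure of `C_c^∞(Λ)` in `H¹(Λ)`;
* Neumann: `u ∈ H¹(Λ)`;
* periodic: `u ∈ H¹_per(Λ)`, the functions in `H¹(Λ)` for which integration by parts against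
  smooth periodic functions produces no boundary terms (that is, the traces of `u` on opposite faces
  coincide). -/
def formGraph {d : ℕ} (a b : Fin d → EReal) :
    BoundaryCondition → Submodule ℂ (L2 (box a b) × L2Field (box a b))
  | .dirichlet =>
      (gradGraph (box a b) ⊓
        (testSpace (box a b)).comap (LinearMap.fst ℂ _ _)).topologicalClosure ⊓
          gradGraph (box a b)
  | .neumann => gradGraph (box a b)
  | .periodic => gradGraph (box a b) ⊓ partsGraph (box a b) (IsBoxPeriodic a b)

/-- The pairs `(u, Δu)`, where `u` is in the form domain and `Δu ∈ L²(Λ)` satisfies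
`⟨∇v, ∇u⟩ = ⟨v, -Δu⟩` for all `v` in the form domain. -/
def laplacianGraph {d : ℕ} (a b : Fin d → EReal) (bc : BoundaryCondition) :
    Submodule ℂ (L2 (box a b) × L2 (box a b)) where
  carrier := {p | ∃ g, (p.1, g) ∈ formGraph a b bc ∧
    ∀ v h, (v, h) ∈ formGraph a b bc → inner ℂ h g = inner ℂ v (-p.2)}
  zero_mem' := ⟨0, (formGraph a b bc).zero_mem, fun v h _ => by simp⟩
  add_mem' := by
    rintro p q ⟨g, hg, h1⟩ ⟨k, hk, h2⟩
    refine ⟨g + k, (formGraph a b bc).add_mem hg hk, fun v h hv => ?_⟩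
    rw [inner_add_right, h1 v h hv, h2 v h hv, ← inner_add_right, Prod.snd_add, neg_add]
  smul_mem' := by
    rintro c p ⟨g, hg, h1⟩
    refine ⟨c • g, (formGraph a b bc).smul_mem c hg, fun v h hv => ?_⟩
    rw [inner_smul_right, h1 v h hv, ← inner_smul_right, Prod.smul_snd, smul_neg]

/-- The Laplacian `Δ_Λ^•` on `L²(Λ)`, `Λ = ⨉_j (a_j, b_j)`, with the given boundary condition:
minus the self-adjoint operator associated with the form `∫_Λ ∇u · ∇v̄` on the form domain
(`laplacian_graph` below shows that `Δu` is unique). -/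
def laplacian {d : ℕ} (a b : Fin d → EReal) (bc : BoundaryCondition) :
    L2 (box a b) →ₗ.[ℂ] L2 (box a b) :=
  (laplacianGraph a b bc).toLinearPMap

/-- `B` is infinitesimally operator bounded with respect to `A`: the domain of `B` contains that
of `A`, and `B` is relatively bounded with respect to `A` with arbitrarily small relative bound. -/
def IsInfinitesimallyBounded {X Y Z : Type*} [NormedAddCommGroup X] [NormedSpace ℂ X]
    [NormedAddCommGroup Y] [NormedSpace ℂ Y] [NormedAddCommGroup Z] [NormedSpace ℂ Z]
    (B : X →ₗ.[ℂ] Z) (A : X →ₗ.[ℂ] Y) : Prop :=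
  A.domain ≤ B.domain ∧ ∀ η : ℝ, 0 < η → ∃ C : ℝ, 0 ≤ C ∧
    ∀ (x : X) (hA : x ∈ A.domain) (hB : x ∈ B.domain),
      ‖B ⟨x, hB⟩‖ ≤ η * ‖A ⟨x, hA⟩‖ + C * ‖x‖

/-! Well-definedness of the gradient and of the Laplacians. -/

lemma eq_zero_of_forall_test {d : ℕ} (Λ : Opens (Space d)) (u : L2 Λ)
    (h : ∀ φ : Space d → ℝ, ContDiff ℝ ∞ φ → CompactlySupportedIn Λ φ →
      ∫ x in (Λ : Set (Space d)), φ x • u x = 0) : u = 0 := by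
  rw [Lp.eq_zero_iff_ae_eq_zero]
  have hloc : LocallyIntegrableOn u (Λ : Set (Space d)) volume := by
    intro x hx
    have h1 : LocallyIntegrable u (volume.restrict (Λ : Set (Space d))) :=
      (Lp.memLp u).locallyIntegrable (by norm_num)
    obtain ⟨s, hs, hsi⟩ := h1 x
    refine ⟨s ∩ Λ, ?_, ?_⟩
    · exact Filter.inter_mem (mem_nhdsWithin_of_mem_nhds hs) self_mem_nhdsWithin
    · rw [IntegrableOn, Measure.restrict_restrict' Λ.isOpen.measurableSet] at hsi
      exact hsi
  have := Λ.isOpen.ae_eq_zero_of_integral_contDiff_smul_eq_zero hloc ?_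
  · exact (ae_restrict_iff' Λ.isOpen.measurableSet).2 this
  · intro φ h1 h2 h3
    rw [← h φ h1 ⟨h2, h3⟩, setIntegral_eq_integral_of_forall_compl_eq_zero]
    intro x hx
    have : φ x = 0 := image_eq_zero_of_notMem_tsupport fun h => hx (h3 h)
    simp [this]

lemma isBounded_of_compactlySupportedIn {d : ℕ} (Λ : Opens (Space d)) {φ : Space d → ℝ}
    (h : CompactlySupportedIn Λ φ) :
    Bornology.IsBounded ((Λ : Set (Space d)) ∩ Function.support φ) :=
  h.1.isBounded.subset (Set.inter_subset_right.trans (subset_tsupport φ))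

lemma gradGraph_single_valued {d : ℕ} (Λ : Opens (Space d)) (p : L2 Λ × L2Field Λ)
    (hp : p ∈ gradGraph Λ) (h0 : p.1 = 0) : p.2 = 0 := by
  refine PiLp.ext fun j => eq_zero_of_forall_test Λ _ fun φ h1 h2 => ?_
  have h := hp j φ h1 (isBounded_of_compactlySupportedIn Λ h2) h2
  rw [h0] at h
  rw [integral_smul_zero] at h
  exact neg_eq_zero.1 h.symm

/-- The graph of the gradient consists exactly of the pairs `(u, ∇u)`. -/
theorem grad_graph {d : ℕ} (Λ : Opens (Space d)) : (grad Λ).graph = gradGraph Λ :=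
  Submodule.toLinearPMap_graph_eq _ (gradGraph_single_valued Λ)

lemma memLp_ofReal {d : ℕ} (Λ : Opens (Space d)) {φ : Space d → ℝ} (h1 : Continuous φ)
    (hb : Bornology.IsBounded ((Λ : Set (Space d)) ∩ Function.support φ)) :
    MemLp (fun x => (φ x : ℂ)) 2 (volume.restrict (Λ : Set (Space d))) :=
  (memLp_of_isBounded Λ h1 hb).ofReal (K := ℂ)

lemma test_mem_partsGraph {d : ℕ} (Λ : Opens (Space d)) (P : (Space d → ℝ) → Prop)
    {φ : Space d → ℝ} (h1 : ContDiff ℝ ∞ φ) (h2 : CompactlySupportedIn Λ φ) :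
    ((memLp_ofReal Λ h1.continuous (isBounded_of_compactlySupportedIn Λ h2)).toLp _,
      WithLp.toLp 2 fun j => (memLp_ofReal Λ (continuous_partialDeriv j h1)
        (isBounded_partialDeriv Λ j (isBounded_of_compactlySupportedIn Λ h2))).toLp _)
      ∈ partsGraph Λ P := by
  intro j χ hχ _ _
  have hzero : ∀ x ∉ (Λ : Set (Space d)), φ x = 0 ∧ partialDeriv j φ x = 0 := by
    intro x hx
    have hx' : x ∉ tsupport φ := fun h => hx (h2.2 h)
    refine ⟨image_eq_zero_of_notMem_tsupport hx', ?_⟩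
    have : fderiv ℝ φ x = 0 := by
      by_contra h
      exact hx' (support_fderiv_subset ℝ h)
    simp [partialDeriv, this]
  have hcs : HasCompactSupport (partialDeriv j φ) := h2.1.fderiv_apply ℝ _
  have parts : ∫ x, φ x * partialDeriv j χ x = - ∫ x, partialDeriv j φ x * χ x := by
    refine integral_mul_fderiv_eq_neg_fderiv_mul_of_integrable ?_ ?_ ?_
      (fun x _ => (h1.differentiable (by simp)) x) (fun x _ => (hχ.differentiable (by simp)) x)
    · exact ((continuous_partialDeriv j h1).mul hχ.continuous).integrable_of_hasCompactSupport
        hcs.mul_right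
    · exact (h1.continuous.mul (continuous_partialDeriv j hχ)).integrable_of_hasCompactSupport
        h2.1.mul_right
    · exact (h1.continuous.mul hχ.continuous).integrable_of_hasCompactSupport h2.1.mul_right
  have e1 : ∫ x in (Λ : Set (Space d)), partialDeriv j χ x •
      ((memLp_ofReal Λ h1.continuous (isBounded_of_compactlySupportedIn Λ h2)).toLp _ : L2 Λ) x
      = ((∫ x, φ x * partialDeriv j χ x : ℝ) : ℂ) := by
    rw [← integral_complex_ofReal, ← setIntegral_eq_integral_of_forall_compl_eq_zero
      (s := (Λ : Set (Space d))) (f := fun x => ((φ x * partialDeriv j χ x : ℝ) : ℂ))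
      (fun x hx => by simp [(hzero x hx).1])]
    refine integral_congr_ae ?_
    filter_upwards [MemLp.coeFn_toLp (memLp_ofReal Λ h1.continuous
      (isBounded_of_compactlySupportedIn Λ h2))] with x hx
    rw [hx]
    simp [mul_comm]
  have e2 : ∫ x in (Λ : Set (Space d)), χ x •
      ((memLp_ofReal Λ (continuous_partialDeriv j h1) (isBounded_partialDeriv Λ j
        (isBounded_of_compactlySupportedIn Λ h2))).toLp _ : L2 Λ) x
      = ((∫ x, partialDeriv j φ x * χ x : ℝ) : ℂ) := by
    rw [← integral_complex_ofReal, ← setIntegral_eq_integral_of_forall_compl_eq_zero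
      (s := (Λ : Set (Space d))) (f := fun x => ((partialDeriv j φ x * χ x : ℝ) : ℂ))
      (fun x hx => by simp [(hzero x hx).2])]
    refine integral_congr_ae ?_
    filter_upwards [MemLp.coeFn_toLp (memLp_ofReal Λ (continuous_partialDeriv j h1)
      (isBounded_partialDeriv Λ j (isBounded_of_compactlySupportedIn Λ h2)))] with x hx
    rw [hx]
    simp [mul_comm]
  change ∫ x in (Λ : Set (Space d)), partialDeriv j χ x •
      ((memLp_ofReal Λ h1.continuous (isBounded_of_compactlySupportedIn Λ h2)).toLp _ : L2 Λ) x
      = - ∫ x in (Λ : Set (Space d)), χ x •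
      ((memLp_ofReal Λ (continuous_partialDeriv j h1) (isBounded_partialDeriv Λ j
        (isBounded_of_compactlySupportedIn Λ h2))).toLp _ : L2 Λ) x
  rw [e1, e2, parts]
  simp

lemma test_mem_formGraph {d : ℕ} (a b : Fin d → EReal) (bc : BoundaryCondition)
    {φ : Space d → ℝ} (h1 : ContDiff ℝ ∞ φ) (h2 : CompactlySupportedIn (box a b) φ) :
    ∃ h, ((memLp_ofReal (box a b) h1.continuous
      (isBounded_of_compactlySupportedIn (box a b) h2)).toLp _, h) ∈ formGraph a b bc := by
  have hP := fun P => test_mem_partsGraph (box a b) P h1 h2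
  refine ⟨WithLp.toLp 2 fun j => (memLp_ofReal (box a b) (continuous_partialDeriv j h1)
    (isBounded_partialDeriv _ j (isBounded_of_compactlySupportedIn _ h2))).toLp _, ?_⟩
  · cases bc with
    | neumann => exact hP _
    | periodic => exact ⟨hP _, hP _⟩
    | dirichlet =>
      refine ⟨Submodule.le_topologicalClosure _ ⟨hP _, ?_⟩, hP _⟩
      refine ⟨fun x => (φ x : ℂ), Complex.ofRealCLM.contDiff.comp h1, ⟨?_, ?_⟩,
        MemLp.coeFn_toLp (memLp_ofReal (box a b) h1.continuous
          (isBounded_of_compactlySupportedIn (box a b) h2))⟩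
      · exact h2.1.comp_left (g := fun r : ℝ => (r : ℂ)) Complex.ofReal_zero
      · exact (tsupport_comp_subset (g := fun r : ℝ => (r : ℂ)) Complex.ofReal_zero φ).trans h2.2

lemma formGraph_le {d : ℕ} (a b : Fin d → EReal) (bc : BoundaryCondition) :
    formGraph a b bc ≤ gradGraph (box a b) := by
  cases bc
  · exact inf_le_right
  · exact le_rfl
  · exact inf_le_left

lemma laplacianGraph_single_valued {d : ℕ} (a b : Fin d → EReal) (bc : BoundaryCondition)
    (p : L2 (box a b) × L2 (box a b)) (hp : p ∈ laplacianGraph a b bc) (h0 : p.1 = 0) :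
    p.2 = 0 := by
  obtain ⟨g, hg, h⟩ := hp
  have hg0 : g = 0 := gradGraph_single_valued _ _ (formGraph_le a b bc hg) h0
  refine eq_zero_of_forall_test _ _ fun φ h1 h2 => ?_
  obtain ⟨k, hk⟩ := test_mem_formGraph a b bc h1 h2
  have h3 := h _ _ hk
  rw [hg0, inner_zero_right, inner_neg_right, eq_comm, neg_eq_zero, L2.inner_def] at h3
  rw [← h3]
  refine integral_congr_ae ?_
  filter_upwards [MemLp.coeFn_toLp (memLp_ofReal (box a b) h1.continuous
    (isBounded_of_compactlySupportedIn (box a b) h2))] with x hx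
  rw [hx]
  simp [mul_comm]

/-- The graph of the Laplacian consists exactly of the pairs `(u, Δu)`. -/
theorem laplacian_graph {d : ℕ} (a b : Fin d → EReal) (bc : BoundaryCondition) :
    (laplacian a b bc).graph = laplacianGraph a b bc :=
  Submodule.toLinearPMap_graph_eq _ (laplacianGraph_single_valued a b bc)

end GenRect

end

open MeasureTheory TopologicalSpace Filter
open scoped ContDiff Topology

namespace GenRect

/-! Admissibility is only an inclusion of domains; the closed graph theorem turns it into an
inequality. The graph of the weak gradient is closed in `L²(Λ) × L²(Λ)^d`, hence complete, and
multiplication by `V` is a closed operator, so `(u, ∇u) ↦ V u` is bounded: `‖V u‖ ≤ M (‖∇u‖ + ‖u‖)`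
(`IsAdmissible.exists_bound`). Squaring this gives (b).

For (a), each form domain lies in `H¹(Λ)`, and testing the weak equation for `Δψ` with `ψ` itself
yields `‖∇ψ‖² ≤ ‖ψ‖ ‖Δψ‖` (`exists_grad_norm_sq_le`). A weighted AM-GM inequality splits this into
`‖∇ψ‖ ≤ ε ‖Δψ‖ + ‖ψ‖ / ε`. Inserted into the bound for `V`, it gives the quantitative estimate with
both constants equal to `M`, and a small `ε` gives infinitesimal boundedness. -/

/-- Integration against a fixed square integrable function is continuous on `L²(Λ)`. -/
lemma continuous_integral_smul {d : ℕ} (Λ : Opens (Space d)) {φ : Space d → ℝ}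
    (hφ : Continuous φ)
    (hb : Bornology.IsBounded ((Λ : Set (Space d)) ∩ Function.support φ)) :
    Continuous fun u : L2 Λ => ∫ x in (Λ : Set (Space d)), φ x • u x := by
  -- The integral is the inner product with the class of `φ`; as `φ` is real, the conjugation
  -- disappears.
  have h : ∀ u : L2 Λ, inner ℂ ((memLp_ofReal Λ hφ hb).toLp _ : L2 Λ) u =
      ∫ x in (Λ : Set (Space d)), φ x • u x := fun u => by
    rw [L2.inner_def]
    refine integral_congr_ae ?_
    filter_upwards [MemLp.coeFn_toLp (memLp_ofReal Λ hφ hb)] with x hx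
    rw [hx]
    simp [mul_comm]
  simp only [← h]
  exact continuous_const.inner continuous_id

/-- Each admitted test function imposes an equation between two continuous functionals of the pair,
and an intersection of such conditions is closed. With test functions supported in `Λ`, this makes
`H¹(Λ)` complete in the graph norm. -/
lemma isClosed_partsGraph {d : ℕ} (Λ : Opens (Space d)) (P : (Space d → ℝ) → Prop) :
    IsClosed (partsGraph Λ P : Set (L2 Λ × L2Field Λ)) := by
  have h : (partsGraph Λ P : Set (L2 Λ × L2Field Λ)) =
      ⋂ (j : Fin d) (φ : Space d → ℝ) (_ : ContDiff ℝ ∞ φ)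
        (_ : Bornology.IsBounded ((Λ : Set (Space d)) ∩ Function.support φ)) (_ : P φ),
        {p | ∫ x in (Λ : Set (Space d)), partialDeriv j φ x • p.1 x
          = - ∫ x in (Λ : Set (Space d)), φ x • p.2 j x} := by
    ext p
    simp only [Set.mem_iInter]
    rfl
  rw [h]
  refine isClosed_iInter fun j => isClosed_iInter fun φ => isClosed_iInter fun hφ =>
    isClosed_iInter fun hb => isClosed_iInter fun _ => isClosed_eq ?_ ?_
  · exact (continuous_integral_smul Λ (continuous_partialDeriv j hφ)
      (isBounded_partialDeriv Λ j hb)).comp continuous_fst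
  · exact ((continuous_integral_smul Λ hφ.continuous hb).comp
      ((PiLp.continuous_apply 2 (fun _ : Fin d => L2 Λ) j).comp continuous_snd)).neg

/-- The multiplication operator by `V` is closed. -/
lemma mulFun_eq_of_tendsto {d : ℕ} (Λ : Opens (Space d)) (V : Space d → ℝ) {u : ℕ → L2 Λ}
    (hu : ∀ n, u n ∈ mulDomain Λ V) {v w : L2 Λ} (hv : v ∈ mulDomain Λ V)
    (huv : Tendsto u atTop (𝓝 v))
    (huw : Tendsto (fun n => mulFun Λ V (u n) (hu n)) atTop (𝓝 w)) : w = mulFun Λ V v hv := by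
  -- `L²` convergence gives a.e. convergence only along a subsequence. The second one is extracted
  -- from the first, so that `u` and `V u` both converge a.e. along `k ∘ l` and the limits can be
  -- compared pointwise.
  obtain ⟨k, hk, hkv⟩ := (tendstoInMeasure_of_tendsto_Lp huv).exists_seq_tendsto_ae
  obtain ⟨l, hl, hlw⟩ := (tendstoInMeasure_of_tendsto_Lp
    (huw.comp hk.tendsto_atTop)).exists_seq_tendsto_ae
  apply Lp.ext
  filter_upwards [hkv, hlw, coeFn_mulFun Λ V v hv,
    ae_all_iff.2 fun n => coeFn_mulFun Λ V (u n) (hu n)] with x h1 h2 h3 h4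
  rw [h3]
  refine tendsto_nhds_unique h2 ?_
  simp only [Function.comp_apply, h4]
  exact (h1.comp hl.tendsto_atTop).const_mul _

/-! ### Boundedness of `V` on `H¹(Λ)` -/

lemma fst_mem_H1 {d : ℕ} (Λ : Opens (Space d)) {p : L2 Λ × L2Field Λ}
    (hp : p ∈ gradGraph Λ) : p.1 ∈ H1 Λ := by
  rw [← grad_graph] at hp
  exact LinearPMap.mem_domain_of_mem_graph hp

/-- By the closed graph theorem, an admissible `V` is bounded from `H¹(Λ)` to `L²(Λ)`. -/
lemma IsAdmissible.exists_bound {d : ℕ} {Λ : Opens (Space d)} {V : Space d → ℝ}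
    (hV : IsAdmissible Λ V) :
    ∃ M : ℝ, 0 ≤ M ∧ ∀ u g, (u, g) ∈ gradGraph Λ → ∀ hu : u ∈ (mulOp Λ V).domain,
      ‖mulOp Λ V ⟨u, hu⟩‖ ≤ M * (‖g‖ + ‖u‖) := by
  have : CompleteSpace (gradGraph Λ) := (isClosed_partsGraph Λ _).completeSpace_coe
  have hmem : ∀ p : gradGraph Λ, p.1.1 ∈ (mulOp Λ V).domain := fun p => hV.2 (fst_mem_H1 Λ p.2)
  -- The graph replaces `H1 Λ` as the domain because it carries a norm equivalent to that of `H¹`,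
  -- whereas `H1 Λ` inherits the `L²` norm.
  let T : gradGraph Λ →ₗ[ℂ] L2 Λ := (mulOp Λ V).toFun ∘ₗ
    ((LinearMap.fst ℂ (L2 Λ) (L2Field Λ)) ∘ₗ (gradGraph Λ).subtype).codRestrict _ hmem
  have hT : Continuous T := by
    refine LinearMap.continuous_of_seq_closed_graph T fun p x y hpx hpy => ?_
    exact mulFun_eq_of_tendsto Λ V (fun n => hmem (p n)) (hmem x)
      ((continuous_fst.comp continuous_subtype_val).continuousAt.tendsto.comp hpx) hpy
  refine ⟨‖(⟨T, hT⟩ : gradGraph Λ →L[ℂ] L2 Λ)‖, ContinuousLinearMap.opNorm_nonneg _, fun u g h hu => ?_⟩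
  refine ((⟨T, hT⟩ : gradGraph Λ →L[ℂ] L2 Λ).le_opNorm ⟨(u, g), h⟩).trans ?_
  gcongr
  -- The norm of the product space is the maximum of `‖u‖` and `‖g‖`.
  refine max_le ?_ ?_
  · simp
  · simp

/-! ### Estimates relative to the Laplacian and the gradient -/

/-- `‖∇ψ‖² ≤ ‖ψ‖ ‖Δψ‖` for `ψ` in the domain of the Laplacian. -/
lemma exists_grad_norm_sq_le {d : ℕ} {a b : Fin d → EReal} {bc : BoundaryCondition}
    (ψ : (laplacian a b bc).domain) :
    ∃ g, ((ψ : L2 (box a b)), g) ∈ gradGraph (box a b) ∧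
      ‖g‖ ^ 2 ≤ ‖(ψ : L2 (box a b))‖ * ‖laplacian a b bc ψ‖ := by
  have h : ((ψ : L2 (box a b)), laplacian a b bc ψ) ∈ laplacianGraph a b bc := by
    rw [← laplacian_graph]
    exact (laplacian a b bc).mem_graph ψ
  obtain ⟨g, hg, hgψ⟩ := h
  refine ⟨g, formGraph_le a b bc hg, ?_⟩
  -- The test element is `ψ` itself: `‖g‖² = ⟨ψ, -Δψ⟩`, and Cauchy–Schwarz finishes.
  have h1 := congrArg norm (hgψ _ _ hg)
  rw [inner_self_eq_norm_sq_to_K, norm_pow, RCLike.norm_ofReal, abs_norm] at h1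
  rw [h1]
  refine (norm_inner_le_norm _ _).trans ?_
  rw [norm_neg]

/-- The product of `ε z` and `x / ε` is `x z` for every `ε`, so the square of their sum dominates `x
z`, hence `y ^ 2`. -/
lemma le_mul_add_div_of_sq_le_mul {x y z ε : ℝ} (hx : 0 ≤ x) (hz : 0 ≤ z) (hε : 0 < ε)
    (h : y ^ 2 ≤ x * z) : y ≤ ε * z + x / ε := by
  have h0 : (ε * z) * (x / ε) = x * z := by field_simp
  have h1 : 0 ≤ ε * z := by positivity
  have h2 : 0 ≤ x / ε := by positivity
  refine abs_le_of_sq_le_sq' ?_ (by positivity) |>.2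
  nlinarith

/-- The relative bound with explicit dependence on `ε`. -/
lemma IsAdmissible.exists_laplacian_bound {d : ℕ} {a b : Fin d → EReal} {V : Space d → ℝ}
    (hV : IsAdmissible (box a b) V) (bc : BoundaryCondition) :
    ∃ M : ℝ, 0 ≤ M ∧ ∀ (ψ : (laplacian a b bc).domain) (ε : ℝ), 0 < ε →
      ∃ hψ : (ψ : L2 (box a b)) ∈ (mulOp (box a b) V).domain,
        ‖mulOp (box a b) V ⟨ψ, hψ⟩‖ ≤ M * ε * ‖laplacian a b bc ψ‖ +
          (M / ε + M) * ‖(ψ : L2 (box a b))‖ := by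
  obtain ⟨M, hM, hbound⟩ := hV.exists_bound
  refine ⟨M, hM, fun ψ ε hε => ?_⟩
  obtain ⟨g, hg, hgψ⟩ := exists_grad_norm_sq_le ψ
  refine ⟨hV.2 (fst_mem_H1 _ hg), (hbound _ _ hg _).trans ?_⟩
  have h := le_mul_add_div_of_sq_le_mul (norm_nonneg _) (norm_nonneg _) hε hgψ
  calc M * (‖g‖ + ‖(ψ : L2 (box a b))‖)
      ≤ M * ((ε * ‖laplacian a b bc ψ‖ + ‖(ψ : L2 (box a b))‖ / ε) + ‖(ψ : L2 (box a b))‖) := by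
        gcongr
    _ = _ := by ring

lemma IsAdmissible.isInfinitesimallyBounded {d : ℕ} {a b : Fin d → EReal} {V : Space d → ℝ}
    (hV : IsAdmissible (box a b) V) (bc : BoundaryCondition) :
    IsInfinitesimallyBounded (mulOp (box a b) V) (laplacian a b bc) := by
  obtain ⟨M, hM, h⟩ := hV.exists_laplacian_bound bc
  -- The value `1` is arbitrary: only the domain inclusion is extracted.
  refine ⟨fun x hx => (h ⟨x, hx⟩ 1 one_pos).1, fun η hη => ?_⟩
  -- This is the `ε` to be used: it makes `M ε ≤ η`, and `M + 1` avoids a division by zero when `M =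
  -- 0`.
  have hε : 0 < η / (M + 1) := by positivity
  refine ⟨M / (η / (M + 1)) + M, by positivity, fun x hA hB => ?_⟩
  refine (h ⟨x, hA⟩ _ hε).2.trans ?_
  gcongr
  rw [mul_div_assoc', div_le_iff₀ (by positivity)]
  nlinarith

lemma IsAdmissible.exists_grad_bound {d : ℕ} {Λ : Opens (Space d)} {V : Space d → ℝ}
    (hV : IsAdmissible Λ V) :
    ∃ l : ℝ, 0 ≤ l ∧ ∀ ψ : (grad Λ).domain,
      ∃ hψ : (ψ : L2 Λ) ∈ (mulOp Λ V).domain,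
        ‖mulOp Λ V ⟨ψ, hψ⟩‖ ^ 2 ≤ l * ‖grad Λ ψ‖ ^ 2 + l * ‖(ψ : L2 Λ)‖ ^ 2 := by
  obtain ⟨M, hM, hbound⟩ := hV.exists_bound
  -- The factor `2` comes from `(x + y)² ≤ 2 (x² + y²)`; the same constant serves both terms.
  refine ⟨2 * M ^ 2, by positivity, fun ψ => ⟨hV.2 ψ.2, ?_⟩⟩
  have hψ : ((ψ : L2 Λ), grad Λ ψ) ∈ gradGraph Λ := by
    rw [← grad_graph]
    exact (grad Λ).mem_graph ψ
  calc ‖mulOp Λ V ⟨ψ, hV.2 ψ.2⟩‖ ^ 2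
      ≤ (M * (‖grad Λ ψ‖ + ‖(ψ : L2 Λ)‖)) ^ 2 := by
        gcongr
        exact hbound _ _ hψ _
    _ = M ^ 2 * (‖grad Λ ψ‖ + ‖(ψ : L2 Λ)‖) ^ 2 := by ring
    _ ≤ M ^ 2 * (2 * (‖grad Λ ψ‖ ^ 2 + ‖(ψ : L2 Λ)‖ ^ 2)) := by
        gcongr
        exact add_sq_le
    _ = _ := by ring

end GenRect

theorem lemma4p1 {d : ℕ} (a b : Fin d → EReal) (hab : ∀ j, a j < b j)
    (V : GenRect.Space d → ℝ) (hV : GenRect.IsAdmissible (GenRect.box a b) V) :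
    (∀ bc : GenRect.BoundaryCondition, bc.Applicable a b →
      GenRect.IsInfinitesimallyBounded (GenRect.mulOp (GenRect.box a b) V)
        (GenRect.laplacian a b bc) ∧
      ∃ α β : ℝ, 0 ≤ α ∧ 0 ≤ β ∧
        ∀ (ψ : (GenRect.laplacian a b bc).domain) (ε : ℝ), 0 < ε →
          ∃ hψ : (ψ : GenRect.L2 (GenRect.box a b)) ∈
              (GenRect.mulOp (GenRect.box a b) V).domain,
            ‖GenRect.mulOp (GenRect.box a b) V ⟨ψ, hψ⟩‖ ≤
              α * ε * ‖GenRect.laplacian a b bc ψ‖ +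
                (α / ε + β) * ‖(ψ : GenRect.L2 (GenRect.box a b))‖) ∧
    ∃ l₁ l₂ : ℝ, 0 ≤ l₁ ∧ 0 ≤ l₂ ∧
      ∀ ψ : (GenRect.grad (GenRect.box a b)).domain,
        ∃ hψ : (ψ : GenRect.L2 (GenRect.box a b)) ∈
            (GenRect.mulOp (GenRect.box a b) V).domain,
          ‖GenRect.mulOp (GenRect.box a b) V ⟨ψ, hψ⟩‖ ^ 2 ≤
            l₁ * ‖GenRect.grad (GenRect.box a b) ψ‖ ^ 2 +
              l₂ * ‖(ψ : GenRect.L2 (GenRect.box a b))‖ ^ 2 := by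
  refine ⟨fun bc _ => ⟨hV.isInfinitesimallyBounded bc, ?_⟩, ?_⟩
  · obtain ⟨M, hM, h⟩ := hV.exists_laplacian_bound bc
    exact ⟨M, M, hM, hM, h⟩
  · obtain ⟨l, hl, h⟩ := hV.exists_grad_bound
    exact ⟨l, l, hl, hl, h⟩
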